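/- There is an absolute constant $C>0$ such that for every $\lambda\in(0,1)$ there is $n_0=n_0(\lambda)$ with the following property. Let $n\ge n_0$, let $|\cdot|$ be a Euclidean norm on $\mathbb R^n$ (coming from an inner product), let $p\in(0,1]$, and let $K\subset\mathbb R^n$ be a $p$-convex body, i.e. a compact set with the origin in its interior, with $tK\subset K$ for all $t\in[0,1]$, and such that $ax+by\in K$ whenever $x,y\in K$, $a,b>0$ and $a^p+b^p=1$ ($K$ need not be centrally symmetric). Let $\|x\|_K=\inf\{r>0: x\in rK\}$ be the gauge of $K$, and put $$\tilde M_K=\frac1{|K|}\int_K|x|\,dx .$$ Then there is a linear subspace $E\subset\mathbb R^n$ with $\dim E=\lfloor\lambda n\rfloor$ such that $$\|x\|_K\ \ge\ \frac{(1-\lambda)^{1/2+1/p}}{a_p\,\tilde M_K}\,|x|\qquad\text{for all }x\in E,$$ where $a_p=C^{\ln(2/p)/p}$. -/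

import Mathlib

open MeasureTheory

/-- `K` is `p`-convex: `a x + b y ∈ K` whenever `x, y ∈ K`, `a, b > 0` and `a ^ p + b ^ p = 1`. -/
def IsPConvex {V : Type*} [AddCommGroup V] [Module ℝ V] (p : ℝ) (K : Set V) : Prop :=
  ∀ a b : ℝ, 0 < a → 0 < b → a ^ p + b ^ p = 1 → ∀ x ∈ K, ∀ y ∈ K, a • x + b • y ∈ K

/-- A (not necessarily symmetric) compact star body: a compact set, star-shaped about the origin,
with the origin in its interior. -/
structure IsStarBody {V : Type*} [NormedAddCommGroup V] [NormedSpace ℝ V] (K : Set V) : Prop where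
  isCompact : IsCompact K
  zero_mem_interior : (0 : V) ∈ interior K
  smul_mem : ∀ t : ℝ, 0 ≤ t → t ≤ 1 → ∀ x ∈ K, t • x ∈ K

/-- The mean of the Euclidean norm over `K`, that is `(1 / |K|) ∫_K |x| dx`. -/
noncomputable def meanNorm {V : Type*} [NormedAddCommGroup V] [InnerProductSpace ℝ V]
    [FiniteDimensional ℝ V] [MeasurableSpace V] [BorelSpace V] (K : Set V) : ℝ :=
  1 / volume.real K * ∫ x in K, ‖x‖

/-!
A body `K` as in the statement has a section of dimension `⌊lam * n⌋` whose radius is at most a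
multiple of `M = meanNorm K`. The section is cut out by the kernel of a Gaussian matrix `g` with
`k = n - ⌊lam * n⌋` rows, and the argument compares volumes directly, with no nets and no operator
norms.

By Markov's inequality, `A = K ∩ ball 0 ρ` with `ρ = 2 * M` has at least half the volume of `K`
(`volume_le_two_mul_volume_inter_closedBall`). Let `x ∈ K` be annihilated by `g`, and let
`a ^ p + b ^ p = 1`. By `p`-convexity, `K` contains the copy `a • x + b • A` of `A`, whose volume
is `b ^ n` times that of `A`, and `g` acts on it as `b • g` acts on `A`. Typically
`‖g u‖ ^ 2 ≤ 2 * k * ρ ^ 2` on average over `u ∈ A`, so the integral of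
`exp (-‖g z‖ ^ 2 / (2 * ρ ^ 2))` over the copy is at least `b ^ n * exp (-k)` times the volume of
`A`. On the other hand a Gaussian matrix rarely sends a long vector near the origin: the
expectation of the integral of the same weight over the points of `K` of norm at least `r` is at
most `(ρ / r) ^ k` times the volume of `K`. Both facts hold for one common `g`
(`exists_tuple_setIntegral_le`). If `a * ‖x‖ ≥ r + ρ`, then the copy consists of points of norm at
least `r`, and the two bounds contradict each other as soon as
`4 * (exp 1 * ρ / r) ^ k < b ^ n` (`exists_tuple_forall_mem_norm_lt`).

With `r = 2 * exp 2 * M` and `b = exp (-(1 - lam) / 2)` this inequality holds for all large `n`,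
since `k ≥ (1 - lam) * n`. The resulting radius `(r + ρ) / a` is of order `M / a`, where
`a = (1 - b ^ p) ^ (1 / p)` is at least `(p * (1 - lam) / 4) ^ (1 / p)`. The bound obtained thus
depends on `lam` only through `(1 - lam) ^ (1 / p)`, slightly better than what is claimed.
-/

open ProbabilityTheory Real

/-! ### Gaussian matrices -/

section Gaussian

variable {V : Type*} [NormedAddCommGroup V] [InnerProductSpace ℝ V] [FiniteDimensional ℝ V]
  [MeasurableSpace V] [BorelSpace V]

lemma map_inner_stdGaussian (z : V) :
    (stdGaussian V).map (fun g => inner ℝ z g) = gaussianReal 0 (‖z‖ ^ 2).toNNReal := by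
  have h := IsGaussian.map_eq_gaussianReal (μ := stdGaussian V) (innerSL ℝ z)
  rw [integral_strongDual_stdGaussian, variance_dual_stdGaussian, innerSL_apply_norm] at h
  exact h

lemma integral_sq_gaussianReal (v : NNReal) : ∫ x, x ^ 2 ∂gaussianReal 0 v = v := by
  have h := variance_fun_id_gaussianReal (μ := 0) (v := v)
  rwa [variance_of_integral_eq_zero (by fun_prop) (integral_id_gaussianReal)] at h

lemma integral_inner_sq_stdGaussian (z : V) :
    ∫ g, inner ℝ z g ^ 2 ∂stdGaussian V = ‖z‖ ^ 2 := by
  have h := integral_sq_gaussianReal (‖z‖ ^ 2).toNNReal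
  rw [← map_inner_stdGaussian, integral_map (by fun_prop) (by fun_prop),
    Real.coe_toNNReal _ (by positivity)] at h
  exact h

lemma integral_exp_neg_sq_gaussianReal {v : NNReal} (hv : v ≠ 0) {θ : ℝ} (hθ : 0 ≤ θ) :
    ∫ x, exp (-(θ * x ^ 2)) ∂gaussianReal 0 v = (√(1 + 2 * θ * v))⁻¹ := by
  have hv' : (0 : ℝ) < v := by positivity
  rw [integral_gaussianReal_eq_integral_smul hv]
  have : ∀ x : ℝ, gaussianPDFReal 0 v x • exp (-(θ * x ^ 2))
      = (√(2 * π * v))⁻¹ * exp (-(θ + 1 / (2 * v)) * x ^ 2) := by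
    intro x
    rw [gaussianPDFReal, smul_eq_mul, mul_assoc, ← exp_add]
    congr 2
    field_simp
    ring
  simp_rw [this]
  rw [integral_const_mul, integral_gaussian, ← Real.sqrt_inv, ← Real.sqrt_inv, ← Real.sqrt_mul
    (by positivity)]
  congr 1
  have : 0 < 1 + 2 * θ * v := by positivity
  field_simp
  ring

/-- A one-dimensional small-ball estimate, in Laplace transform form. -/
lemma integral_exp_neg_inner_sq_le {ρ r : ℝ} (hρ : 0 < ρ) (hr : 0 < r) {z : V} (hz : r ≤ ‖z‖) :
    ∫ g, exp (-(1 / (2 * ρ ^ 2) * inner ℝ z g ^ 2)) ∂stdGaussian V ≤ ρ / r := by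
  have hz' : 0 < ‖z‖ := hr.trans_le hz
  have h := integral_exp_neg_sq_gaussianReal (v := (‖z‖ ^ 2).toNNReal) (by positivity)
    (θ := 1 / (2 * ρ ^ 2)) (by positivity)
  rw [← map_inner_stdGaussian, integral_map (by fun_prop) (by fun_prop),
    Real.coe_toNNReal _ (by positivity)] at h
  rw [h, ← inv_div r ρ]
  apply inv_anti₀ (by positivity)
  apply Real.le_sqrt_of_sq_le
  have : r ^ 2 ≤ ‖z‖ ^ 2 := by gcongr
  rw [div_pow]
  calc r ^ 2 / ρ ^ 2 ≤ ‖z‖ ^ 2 / ρ ^ 2 := by gcongr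
    _ ≤ _ := by
      have : 2 * (1 / (2 * ρ ^ 2)) * ‖z‖ ^ 2 = ‖z‖ ^ 2 / ρ ^ 2 := by field_simp
      linarith

/-- The standard Gaussian measure on `k`-tuples of vectors, that is on `k × n` matrices. -/
noncomputable abbrev gaussianTuple (V : Type*) [NormedAddCommGroup V] [InnerProductSpace ℝ V]
    [FiniteDimensional ℝ V] [MeasurableSpace V] [BorelSpace V] (k : ℕ) :
    Measure (Fin k → V) :=
  Measure.pi fun _ => stdGaussian V

lemma integral_exp_neg_sum_inner_sq_le {ρ r : ℝ} (hρ : 0 < ρ) (hr : 0 < r) {z : V} (hz : r ≤ ‖z‖)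
    (k : ℕ) :
    ∫ g, exp (-(1 / (2 * ρ ^ 2) * ∑ i, inner ℝ z (g i) ^ 2)) ∂gaussianTuple V k
      ≤ (ρ / r) ^ k := by
  have : ∀ g : Fin k → V, exp (-(1 / (2 * ρ ^ 2) * ∑ i, inner ℝ z (g i) ^ 2))
      = ∏ i, exp (-(1 / (2 * ρ ^ 2) * inner ℝ z (g i) ^ 2)) := by
    intro g
    rw [← exp_sum, Finset.mul_sum, Finset.sum_neg_distrib]
  simp_rw [this]
  rw [integral_fintype_prod_eq_pow (𝕜 := ℝ)
    (f := fun g : V => exp (-(1 / (2 * ρ ^ 2) * inner ℝ z g ^ 2))), Fintype.card_fin]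
  exact pow_le_pow_left₀ (integral_nonneg fun _ => (exp_pos _).le)
    (integral_exp_neg_inner_sq_le hρ hr hz) _

/-- If every point of `S` has norm at least `r`, then for a Gaussian matrix `g` the mass of `S`
that `g` maps close to the origin is exponentially small in the number `k` of rows on average. -/
lemma integrable_and_integral_setIntegral_exp_le {S : Set V} (hS : MeasurableSet S)
    (hfin : volume S ≠ ⊤)
    {ρ r : ℝ} (hρ : 0 < ρ) (hr : 0 < r) (hSr : ∀ z ∈ S, r ≤ ‖z‖) (k : ℕ) :
    Integrable (fun g : Fin k → V =>
        ∫ z in S, exp (-(1 / (2 * ρ ^ 2) * ∑ i, inner ℝ z (g i) ^ 2))) (gaussianTuple V k) ∧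
      ∫ g, (∫ z in S, exp (-(1 / (2 * ρ ^ 2) * ∑ i, inner ℝ z (g i) ^ 2))) ∂gaussianTuple V k
        ≤ (ρ / r) ^ k * volume.real S := by
  have : IsFiniteMeasure (volume.restrict S) := ⟨by simpa using hfin.lt_top⟩
  have hint : Integrable (Function.uncurry fun (g : Fin k → V) (z : V) =>
      exp (-(1 / (2 * ρ ^ 2) * ∑ i, inner ℝ z (g i) ^ 2)))
      ((gaussianTuple V k).prod (volume.restrict S)) := by
    refine Integrable.of_bound (C := 1) (Continuous.aestronglyMeasurable ?_) (ae_of_all _ ?_)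
    · simp only [Function.uncurry_def]
      fun_prop
    · rintro ⟨g, z⟩
      rw [Function.uncurry_apply_pair, Real.norm_of_nonneg (exp_pos _).le, exp_le_one_iff]
      have : 0 ≤ ∑ i, inner ℝ z (g i) ^ 2 := by positivity
      have : 0 ≤ 1 / (2 * ρ ^ 2) * ∑ i, inner ℝ z (g i) ^ 2 := by positivity
      linarith
  refine ⟨hint.integral_prod_left, ?_⟩
  rw [integral_integral_swap hint]
  calc _ ≤ ∫ z in S, (ρ / r) ^ k := by
        refine setIntegral_mono_on hint.integral_prod_right (integrable_const _) hS ?_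
        intro z hz
        exact integral_exp_neg_sum_inner_sq_le hρ hr (hSr z hz) k
    _ = _ := by rw [setIntegral_const, smul_eq_mul, mul_comm]

lemma integrable_and_integral_setIntegral_inner_sq_le {A : Set V} (hA : MeasurableSet A)
    (hfin : volume A ≠ ⊤) {ρ : ℝ} (hAρ : ∀ u ∈ A, ‖u‖ ≤ ρ) :
    Integrable (fun g : V => ∫ u in A, inner ℝ u g ^ 2) (stdGaussian V) ∧
      ∫ g, (∫ u in A, inner ℝ u g ^ 2) ∂stdGaussian V ≤ ρ ^ 2 * volume.real A := by
  have : IsFiniteMeasure (volume.restrict A) := ⟨by simpa using hfin.lt_top⟩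
  have hint : Integrable (Function.uncurry fun (g : V) (u : V) => inner ℝ u g ^ 2)
      ((stdGaussian V).prod (volume.restrict A)) := by
    have h1 : Integrable (fun g : V => ‖g‖ ^ 2) (stdGaussian V) :=
      (IsGaussian.memLp_id (stdGaussian V) 2 (by simp)).integrable_norm_pow (by simp)
    have h2 : Integrable (fun _ : V => ρ ^ 2) (volume.restrict A) := integrable_const _
    refine (h1.mul_prod h2).mono' (Continuous.aestronglyMeasurable ?_) ?_
    · simp only [Function.uncurry_def]
      fun_prop
    · have h3 : ∀ᵐ q ∂(stdGaussian V).prod (volume.restrict A), q.2 ∈ A :=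
        Measure.quasiMeasurePreserving_snd.ae (ae_restrict_mem hA)
      filter_upwards [h3] with q hq
      rw [Function.uncurry_def, norm_pow, ← mul_pow]
      gcongr
      calc _ ≤ ‖q.2‖ * ‖q.1‖ := norm_inner_le_norm _ _
        _ ≤ _ := by rw [mul_comm]; gcongr; exact hAρ _ hq
  refine ⟨hint.integral_prod_left, ?_⟩
  rw [integral_integral_swap hint]
  simp_rw [integral_inner_sq_stdGaussian]
  calc _ ≤ ∫ z in A, ρ ^ 2 := by
        refine setIntegral_mono_on ?_ (integrable_const _) hA ?_
        · have h := hint.integral_prod_right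
          simp only [Function.uncurry_apply_pair, integral_inner_sq_stdGaussian] at h
          exact h
        intro z hz
        have := hAρ z hz
        gcongr
    _ = _ := by rw [setIntegral_const, smul_eq_mul, mul_comm]

/-- Markov's inequality and a union bound: two nonnegative functions are simultaneously at most
twice their means somewhere. -/
lemma exists_le_two_mul_of_integral_le {Ω : Type*} [MeasurableSpace Ω] {μ : Measure Ω}
    [IsProbabilityMeasure μ] {X Y : Ω → ℝ} (hX : Integrable X μ) (hY : Integrable Y μ)
    (hX0 : ∀ ω, 0 ≤ X ω) (hY0 : ∀ ω, 0 ≤ Y ω) {a b : ℝ} (ha : 0 < a) (hb : 0 < b)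
    (hXa : ∫ ω, X ω ∂μ ≤ a) (hYb : ∫ ω, Y ω ∂μ ≤ b) : ∃ ω, X ω ≤ 2 * a ∧ Y ω ≤ 2 * b := by
  obtain ⟨ω, hω⟩ := exists_le_integral (μ := μ) ((hX.mul_const b).add (hY.mul_const a))
  have hle : X ω * b + Y ω * a ≤ 2 * a * b := by
    have h := hω
    simp only [Pi.add_apply] at h
    rw [integral_add (hX.mul_const b) (hY.mul_const a), integral_mul_const,
      integral_mul_const] at h
    nlinarith
  refine ⟨ω, ?_, ?_⟩
  · refine le_of_mul_le_mul_right (a := b) ?_ hb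
    nlinarith [mul_nonneg (hY0 ω) ha.le]
  · refine le_of_mul_le_mul_right (a := a) ?_ ha
    nlinarith [mul_nonneg (hX0 ω) hb.le]

/-- There is a `k × n` matrix which maps only few points of `S` close to the origin, and which does
not stretch the points of `A` too much on average. -/
lemma exists_tuple_setIntegral_le {S A : Set V} (hS : MeasurableSet S)
    (hA : MeasurableSet A) (hSfin : volume S ≠ ⊤) (hAfin : volume A ≠ ⊤) {m ρ r : ℝ} (hm : 0 < m)
    (hSm : volume.real S ≤ m) (hA0 : 0 < volume.real A) (hρ : 0 < ρ) (hr : 0 < r)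
    (hSr : ∀ z ∈ S, r ≤ ‖z‖) (hAρ : ∀ u ∈ A, ‖u‖ ≤ ρ) {k : ℕ} (hk : 0 < k) :
    ∃ g : Fin k → V,
      ∫ z in S, exp (-(1 / (2 * ρ ^ 2) * ∑ i, inner ℝ z (g i) ^ 2)) ≤ 2 * ((ρ / r) ^ k * m) ∧
      ∑ i, ∫ u in A, inner ℝ u (g i) ^ 2 ≤ 2 * (k * (ρ ^ 2 * volume.real A)) := by
  obtain ⟨h1, h2⟩ := integrable_and_integral_setIntegral_exp_le hS hSfin hρ hr hSr k
  obtain ⟨h3, h4⟩ := integrable_and_integral_setIntegral_inner_sq_le hA hAfin hAρ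
  have h5 : ∀ i : Fin k, Integrable (fun g : Fin k → V => ∫ u in A, inner ℝ u (g i) ^ 2)
      (gaussianTuple V k) := fun i =>
    integrable_comp_eval (μ := fun _ => stdGaussian V) (i := i)
      (f := fun g : V => ∫ u in A, inner ℝ u g ^ 2) h3
  refine exists_le_two_mul_of_integral_le (μ := gaussianTuple V k) h1
    (integrable_finsetSum _ fun i _ => h5 i) (fun g => integral_nonneg fun _ => (exp_pos _).le)
    (fun g => Finset.sum_nonneg fun i _ => integral_nonneg fun _ => sq_nonneg _)
    (by positivity) (by positivity) (h2.trans (by gcongr)) ?_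
  rw [integral_finsetSum _ fun i _ => h5 i]
  calc _ ≤ ∑ i : Fin k, ρ ^ 2 * volume.real A := by
        refine Finset.sum_le_sum fun i _ => ?_
        exact (integral_comp_eval (μ := fun _ => stdGaussian V) (i := i)
          (f := fun g : V => ∫ u in A, inner ℝ u g ^ 2) h3.aestronglyMeasurable).trans_le h4
    _ = _ := by simp

end Gaussian

/-! ### Sections, gauges and shrunk copies of a body -/

/-- A diameter bound for the section `K ∩ E` is a lower bound for the gauge of `K` on `E`. -/
lemma mul_norm_le_gauge_of_forall_norm_le {V : Type*}
    [NormedAddCommGroup V] [NormedSpace ℝ V] {K : Set V} (hK : (0 : V) ∈ interior K) {R : ℝ}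
    (E : Submodule ℝ V) (hE : ∀ y ∈ E, y ∈ K → ‖y‖ ≤ R) {c : ℝ} (hc : 0 ≤ c) (hcR : c * R ≤ 1)
    {x : V} (hx : x ∈ E) : c * ‖x‖ ≤ gauge K x := by
  have habs : Absorbent ℝ K := absorbent_nhds_zero (mem_interior_iff_mem_nhds.1 hK)
  rw [gauge]
  refine le_csInf habs.gauge_set_nonempty ?_
  rintro t ⟨ht, y, hy, rfl⟩
  have ht' : 0 < t := ht
  have hyE : y ∈ E := by
    have := E.smul_mem t⁻¹ hx
    simpa [smul_smul, ht'.ne'] using this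
  show c * ‖t • y‖ ≤ t
  rw [norm_smul, norm_of_nonneg ht'.le]
  calc c * (t * ‖y‖) = t * (c * ‖y‖) := by ring
    _ ≤ t * (c * R) := by gcongr; exact hE y hyE hy
    _ ≤ t := by nlinarith

lemma exists_submodule_finrank_eq_forall_inner_eq_zero {V : Type*} [NormedAddCommGroup V]
    [InnerProductSpace ℝ V] [FiniteDimensional ℝ V] {k d : ℕ} (g : Fin k → V)
    (hd : d + k = Module.finrank ℝ V) :
    ∃ E : Submodule ℝ V, Module.finrank ℝ E = d ∧ ∀ x ∈ E, ∀ i, inner ℝ x (g i) = 0 := by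
  let T : V →ₗ[ℝ] Fin k → ℝ := LinearMap.pi fun i => innerₗ V (g i)
  have h1 := T.finrank_range_add_finrank_ker
  have h2 : Module.finrank ℝ (LinearMap.range T) ≤ k := by
    simpa using (LinearMap.range T).finrank_le
  obtain ⟨f, hf⟩ := exists_linearIndependent_of_le_finrank (R := ℝ) (M := LinearMap.ker T) (n := d)
    (by omega)
  refine ⟨Submodule.span ℝ (Set.range (Subtype.val ∘ f)), ?_, fun x hx i => ?_⟩
  · exact (finrank_span_eq_card
      (hf.map' (LinearMap.ker T).subtype (Submodule.ker_subtype _))).trans (Fintype.card_fin d)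
  · have hx' : x ∈ LinearMap.ker T :=
      Submodule.span_le.2 (Set.range_subset_iff.2 fun j => (f j).2) hx
    rw [real_inner_comm]
    exact congrFun (LinearMap.mem_ker.1 hx') i

section Geometry

variable {V : Type*} [NormedAddCommGroup V] [InnerProductSpace ℝ V] [FiniteDimensional ℝ V]
  [MeasurableSpace V] [BorelSpace V]

/-- Change of variables `z = x + b • u`. -/
lemma pow_mul_setIntegral_comp_le {A S : Set V} (hA : MeasurableSet A) (hS : MeasurableSet S)
    {b : ℝ} (hb : 0 < b) (x : V) (hAS : ∀ u ∈ A, x + b • u ∈ S) {φ : V → ℝ} (hφ : ∀ z, 0 ≤ φ z)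
    (hint : IntegrableOn φ S) :
    b ^ Module.finrank ℝ V * ∫ u in A, φ (x + b • u) ≤ ∫ z in S, φ z := by
  set f : V → ℝ := S.indicator φ with hf
  have hfint : Integrable f := (integrable_indicator_iff hS).2 hint
  have hfint' : Integrable fun u => f (x + b • u) :=
    (hfint.comp_add_left x).comp_smul hb.ne'
  have h1 : ∫ u in A, φ (x + b • u) ≤ ∫ u, f (x + b • u) := by
    rw [← integral_indicator hA]
    refine integral_mono_of_nonneg (ae_of_all _ fun u => Set.indicator_nonneg (fun _ _ => hφ _) u)
      hfint' (ae_of_all _ fun u => ?_)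
    by_cases hu : u ∈ A
    · simp [hu, hf, hAS u hu]
    · simpa [hu] using Set.indicator_nonneg (fun _ _ => hφ _) _
  have h2 : ∫ u, f (x + b • u) = (b ^ Module.finrank ℝ V)⁻¹ * ∫ z, f z := by
    rw [Measure.integral_comp_smul volume (fun z => f (x + z)) b,
      integral_add_left_eq_self f x, abs_of_pos (by positivity), smul_eq_mul]
  rw [h2, integral_indicator hS] at h1
  calc _ ≤ b ^ Module.finrank ℝ V * ((b ^ Module.finrank ℝ V)⁻¹ * ∫ z in S, φ z) := by gcongr
    _ = _ := by field_simp

/-- Jensen's inequality for `exp`, in the form given by its tangent line at `-m`. -/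
lemma exp_neg_mul_le_setIntegral_exp_neg {A : Set V}
    (hAfin : volume A ≠ ⊤) {q : V → ℝ} (hq : IntegrableOn q A)
    (hq' : IntegrableOn (fun u => exp (-q u)) A) {m : ℝ}
    (hm : ∫ u in A, q u ≤ m * volume.real A) :
    exp (-m) * volume.real A ≤ ∫ u in A, exp (-q u) := by
  have hc : IntegrableOn (fun _ : V => 1 + m) A := integrableOn_const hAfin
  calc exp (-m) * volume.real A
      ≤ exp (-m) * ((1 + m) * volume.real A - ∫ u in A, q u) := by
        gcongr
        linarith
    _ = ∫ u in A, exp (-m) * (1 + m - q u) := by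
        rw [integral_const_mul, integral_sub hc hq, setIntegral_const, smul_eq_mul,
          mul_comm (volume.real A)]
    _ ≤ _ := by
        refine integral_mono ((hc.sub hq).const_mul _) hq' fun u => ?_
        have h : -q u = -m + (m - q u) := by ring
        simp only []
        rw [h, exp_add]
        gcongr
        linarith [add_one_le_exp (m - q u)]

/-- The geometric core. A point `x` of the body annihilated by all rows of the matrix `g` generates
the shrunk copy `a • x + b • A ⊆ K` of the large part `A = K ∩ ball 0 ρ` of the body. On that copy
`g` acts as `b` times its restriction to `A`, so it takes small values there on average; if `x` were
long, the copy would stay away from the origin, where `g` takes small values only rarely. -/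
lemma exists_tuple_forall_mem_norm_lt {K : Set V} {p : ℝ} (hK : IsCompact K)
    (hKp : IsPConvex p K) {ρ r a b : ℝ} (hρ : 0 < ρ) (hr : 0 < r)
    (hA : volume.real K ≤ 2 * volume.real (K ∩ Metric.closedBall 0 ρ)) (hK0 : 0 < volume.real K)
    (ha : 0 < a) (hb : 0 < b) (hb1 : b ≤ 1) (hab : a ^ p + b ^ p = 1) {k : ℕ} (hk : 0 < k)
    (hkr : 4 * (exp 1 * (ρ / r)) ^ k < b ^ Module.finrank ℝ V) :
    ∃ g : Fin k → V, ∀ x ∈ K, (∀ i, inner ℝ x (g i) = 0) → a * ‖x‖ < r + ρ := by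
  set A := K ∩ Metric.closedBall 0 ρ
  set S := K ∩ {z | r ≤ ‖z‖}
  have hAc : IsCompact A := hK.inter_right Metric.isClosed_closedBall
  have hSc : IsCompact S := hK.inter_right (isClosed_le continuous_const continuous_norm)
  have hA0 : 0 < volume.real A := by linarith
  obtain ⟨g, hgS, hgA⟩ := exists_tuple_setIntegral_le hSc.measurableSet hAc.measurableSet
    hSc.measure_ne_top hAc.measure_ne_top hK0
    (measureReal_mono Set.inter_subset_left hK.measure_ne_top) hA0 hρ hr
    (fun z hz => hz.2) (fun u hu => by simpa using hu.2) hk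
  refine ⟨g, fun x hx hgx => ?_⟩
  by_contra! hlong
  set q : V → ℝ := fun z => 1 / (2 * ρ ^ 2) * ∑ i, inner ℝ z (g i) ^ 2 with hq
  have hqc : Continuous q := by fun_prop
  have hmem : ∀ u ∈ A, a • x + b • u ∈ S := by
    rintro u ⟨huK, hu⟩
    refine ⟨hKp a b ha hb hab x hx u huK, ?_⟩
    have h1 : ‖u‖ ≤ ρ := by simpa using hu
    have h2 : ‖b • u‖ ≤ ρ := by
      rw [norm_smul, norm_of_nonneg hb.le]
      nlinarith [norm_nonneg u]
    have h3 : ‖a • x‖ = a * ‖x‖ := by rw [norm_smul, norm_of_nonneg ha.le]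
    have h4 := norm_sub_le (a • x + b • u) (b • u)
    rw [add_sub_cancel_right] at h4
    show r ≤ ‖a • x + b • u‖
    linarith
  have hcomp : ∀ u, q (a • x + b • u) ≤ q u := by
    intro u
    simp only [hq]
    refine mul_le_mul_of_nonneg_left (Finset.sum_le_sum fun i _ => ?_) (by positivity)
    rw [inner_add_left, inner_smul_left, inner_smul_left, hgx i]
    simp only [conj_trivial, mul_zero, zero_add, mul_pow]
    nlinarith [sq_nonneg (inner ℝ u (g i)), pow_le_one₀ (n := 2) hb.le hb1]
  have hcont : Continuous fun z => exp (-q z) := by fun_prop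
  have h1 := pow_mul_setIntegral_comp_le hAc.measurableSet hSc.measurableSet hb (a • x) hmem
    (φ := fun z => exp (-q z)) (fun z => (exp_pos _).le) (hcont.continuousOn.integrableOn_compact hSc)
  have h2 : ∫ u in A, exp (-q u) ≤ ∫ u in A, exp (-q (a • x + b • u)) := by
    refine integral_mono (hcont.continuousOn.integrableOn_compact hAc)
      ((by fun_prop : Continuous fun u => exp (-q (a • x + b • u))).continuousOn.integrableOn_compact
        hAc) fun u => ?_
    exact exp_le_exp.2 (neg_le_neg (hcomp u))
  have h3 : exp (-(k : ℝ)) * volume.real A ≤ ∫ u in A, exp (-q u) := by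
    refine exp_neg_mul_le_setIntegral_exp_neg hAc.measure_ne_top
      (hqc.continuousOn.integrableOn_compact hAc) (hcont.continuousOn.integrableOn_compact hAc) ?_
    rw [integral_const_mul, integral_finsetSum]
    · calc _ ≤ 1 / (2 * ρ ^ 2) * (2 * (k * (ρ ^ 2 * volume.real A))) := by gcongr
        _ = _ := by field_simp
    · intro i _
      exact (by fun_prop : Continuous fun u => inner ℝ u (g i) ^ 2).continuousOn.integrableOn_compact
        hAc
  have h4 : b ^ Module.finrank ℝ V * (exp (-(k : ℝ)) * volume.real A)
      ≤ 2 * ((ρ / r) ^ k * (2 * volume.real A)) :=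
    calc _ ≤ b ^ Module.finrank ℝ V * ∫ u in A, exp (-q (a • x + b • u)) := by
          gcongr
          exact h3.trans h2
      _ ≤ _ := h1
      _ ≤ _ := hgS
      _ ≤ _ := by gcongr
  have h5 : exp 1 ^ k * exp (-(k : ℝ)) = 1 := by
    rw [← exp_nat_mul, ← exp_add]
    simp
  have h6 : b ^ Module.finrank ℝ V * exp (-(k : ℝ)) ≤ 4 * (ρ / r) ^ k :=
    le_of_mul_le_mul_right (by linarith) hA0
  have h7 : b ^ Module.finrank ℝ V ≤ 4 * (exp 1 * (ρ / r)) ^ k :=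
    calc b ^ Module.finrank ℝ V
        = exp 1 ^ k * (b ^ Module.finrank ℝ V * exp (-(k : ℝ))) := by
          rw [mul_left_comm, h5, mul_one]
      _ ≤ exp 1 ^ k * (4 * (ρ / r) ^ k) := by gcongr
      _ = _ := by rw [mul_pow]; ring
  linarith

/-- Markov's inequality: at least half of the body lies within twice the mean norm. -/
lemma volume_le_two_mul_volume_inter_closedBall {K : Set V} (hK : IsCompact K)
    (hK0 : 0 < volume.real K) (hM : 0 < meanNorm K) :
    volume.real K ≤ 2 * volume.real (K ∩ Metric.closedBall 0 (2 * meanNorm K)) := by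
  have hnorm : IntegrableOn (fun x : V => ‖x‖) K :=
    continuous_norm.continuousOn.integrableOn_compact hK
  have h1 := mul_meas_ge_le_integral_of_nonneg (μ := volume.restrict K)
    (ae_of_all _ fun x : V => norm_nonneg x) hnorm (2 * meanNorm K)
  have h2 : ∫ x in K, ‖x‖ = meanNorm K * volume.real K := by
    rw [meanNorm]
    field_simp
  rw [h2, measureReal_restrict_apply (measurableSet_le measurable_const measurable_norm)] at h1
  have h3 : volume.real K ≤ volume.real (K ∩ Metric.closedBall 0 (2 * meanNorm K))
      + volume.real ({x : V | 2 * meanNorm K ≤ ‖x‖} ∩ K) := by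
    refine (measureReal_mono ?_ ?_).trans (measureReal_union_le _ _)
    · intro x hx
      rcases le_total ‖x‖ (2 * meanNorm K) with h | h
      · exact Or.inl ⟨hx, by simpa using h⟩
      · exact Or.inr ⟨h, hx⟩
    · exact measure_ne_top_of_subset
        (Set.union_subset Set.inter_subset_left Set.inter_subset_right) hK.measure_ne_top
  have h4 : 2 * volume.real ({x : V | 2 * meanNorm K ≤ ‖x‖} ∩ K) ≤ volume.real K :=
    le_of_mul_le_mul_left (by linarith) hM
  linarith

end Geometry

/-! ### Numerical constants -/

section Constants

lemma half_le_one_sub_exp_neg {x : ℝ} (h0 : 0 ≤ x) (h1 : x ≤ 1) : x / 2 ≤ 1 - exp (-x) := by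
  have h2 : exp (-x) ≤ (x + 1)⁻¹ := by
    rw [exp_neg]
    exact inv_anti₀ (by linarith) (add_one_le_exp x)
  have h3 : (x + 1)⁻¹ ≤ 1 - x / 2 := by
    rw [inv_le_iff_one_le_mul₀ (by linarith)]
    nlinarith
  linarith

/-- The constant `C = exp 7` absorbs the factor `2 * exp 2 + 2` and the factor `(4 / p) ^ (1 / p)`:
with it, `C ^ (log (2 / p) / p) = (2 / p) ^ (7 / p)`. -/
lemma rpow_mul_le_exp_seven_rpow_mul {p t : ℝ} (hp0 : 0 < p) (hp1 : p ≤ 1) (ht0 : 0 < t)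
    (ht1 : t ≤ 1) :
    t ^ (1 / 2 + 1 / p) * (2 * exp 2 + 2)
      ≤ exp 7 ^ (log (2 / p) / p) * (1 - exp (-(p * t / 2))) ^ (1 / p) := by
  have h2p : 2 ≤ 2 / p := by rw [le_div_iff₀ hp0]; linarith
  have hinv : 1 ≤ 1 / p := by rw [le_div_iff₀ hp0]; linarith
  have hC : exp 7 ^ (log (2 / p) / p) = (2 / p) ^ (7 / p) := by
    rw [← exp_mul, rpow_def_of_pos (by positivity)]
    congr 1
    ring
  have ha : (p * t / 4) ^ (1 / p) ≤ (1 - exp (-(p * t / 2))) ^ (1 / p) := by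
    have h := half_le_one_sub_exp_neg (x := p * t / 2) (by positivity) (by nlinarith)
    gcongr
    linarith
  have hp4 : (2 / p) ^ (-2 / p) ≤ (p / 4) ^ (1 / p) := by
    have h : (2 / p) ^ (-2 / p) = (p ^ 2 / 4) ^ (1 / p) := by
      rw [show -2 / p = (-2) * (1 / p) by ring, rpow_mul (by positivity)]
      congr 1
      rw [rpow_neg (by positivity), rpow_ofNat]
      field_simp
      norm_num
    rw [h]
    gcongr
    nlinarith
  have h32 : 2 * exp 2 + 2 ≤ (2 / p) ^ (5 / p) := by
    have h1 : exp 2 ≤ 3 ^ 2 := by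
      rw [show (2 : ℝ) = (2 : ℕ) * 1 by norm_num, exp_nat_mul]
      gcongr
      linarith [exp_one_lt_d9]
    calc 2 * exp 2 + 2 ≤ (2 : ℝ) ^ (5 : ℝ) := by rw [rpow_ofNat]; norm_num; linarith
      _ ≤ (2 / p) ^ (5 : ℝ) := by gcongr
      _ ≤ (2 / p) ^ (5 / p) := by
        apply rpow_le_rpow_of_exponent_le (by linarith)
        rw [le_div_iff₀ hp0]
        linarith
  calc t ^ (1 / 2 + 1 / p) * (2 * exp 2 + 2)
      ≤ t ^ (1 / p) * (2 / p) ^ (5 / p) := by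
        gcongr ?_ * ?_
        exact rpow_le_rpow_of_exponent_ge ht0 ht1 (by linarith)
    _ = (2 / p) ^ (7 / p) * ((2 / p) ^ (-2 / p) * t ^ (1 / p)) := by
        rw [← mul_assoc, ← rpow_add (by positivity), mul_comm]
        congr 2
        ring
    _ ≤ (2 / p) ^ (7 / p) * ((p / 4) ^ (1 / p) * t ^ (1 / p)) := by gcongr
    _ = (2 / p) ^ (7 / p) * (p * t / 4) ^ (1 / p) := by
        rw [← mul_rpow (by positivity) (by positivity)]
        congr 2
        ring
    _ ≤ _ := by rw [hC]; gcongr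

end Constants

/-! ### Low-radius sections of `p`-convex bodies -/

lemma IsStarBody.volume_real_pos {V : Type*} [NormedAddCommGroup V] [InnerProductSpace ℝ V]
    [FiniteDimensional ℝ V] [MeasurableSpace V] [BorelSpace V] {K : Set V} (hK : IsStarBody K) :
    0 < volume.real K :=
  ENNReal.toReal_pos (Measure.measure_pos_of_nonempty_interior _ ⟨0, hK.zero_mem_interior⟩).ne'
    hK.isCompact.measure_ne_top

lemma IsStarBody.meanNorm_pos {V : Type*} [NormedAddCommGroup V] [InnerProductSpace ℝ V]
    [FiniteDimensional ℝ V] [Nontrivial V] [MeasurableSpace V] [BorelSpace V] {K : Set V}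
    (hK : IsStarBody K) : 0 < meanNorm K := by
  refine mul_pos (one_div_pos.2 hK.volume_real_pos) ?_
  rw [setIntegral_pos_iff_support_of_nonneg_ae (ae_of_all _ fun x => norm_nonneg x)
    (continuous_norm.continuousOn.integrableOn_compact hK.isCompact)]
  have h : (Function.support fun x : V => ‖x‖) ∩ K = K \ {0} := by
    ext x
    simp [and_comm]
  rw [h, measure_sdiff_null (measure_singleton 0)]
  exact Measure.measure_pos_of_nonempty_interior _ ⟨0, hK.zero_mem_interior⟩

theorem theorem3 :
    ∃ C : ℝ, 0 < C ∧
      ∀ lam : ℝ, 0 < lam → lam < 1 →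
        ∃ n₀ : ℕ, ∀ n : ℕ, n₀ ≤ n →
          ∀ (V : Type) [NormedAddCommGroup V] [InnerProductSpace ℝ V] [FiniteDimensional ℝ V]
            [MeasurableSpace V] [BorelSpace V], Module.finrank ℝ V = n →
          ∀ p : ℝ, 0 < p → p ≤ 1 →
          ∀ K : Set V, IsStarBody K → IsPConvex p K →
            ∃ E : Submodule ℝ V, Module.finrank ℝ E = ⌊lam * n⌋₊ ∧
              ∀ x ∈ E,
                (1 - lam) ^ (1 / 2 + 1 / p) / (C ^ (Real.log (2 / p) / p) * meanNorm K) * ‖x‖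
                  ≤ gauge K x := by
  refine ⟨exp 7, exp_pos 7, fun lam hl0 hl1 => ⟨⌈4 / (1 - lam)⌉₊, ?_⟩⟩
  intro n hn V _ _ _ _ _ hV p hp0 hp1 K hK hKp
  have ht0 : 0 < 1 - lam := by linarith
  have hn4 : 4 ≤ (1 - lam) * n := by
    have h := Nat.ceil_le.1 hn
    rwa [div_le_iff₀ ht0, mul_comm] at h
  have hn0 : (0 : ℝ) < n := by
    by_contra! h
    nlinarith
  have : Nontrivial V := Module.nontrivial_of_finrank_pos (R := ℝ) (by rw [hV]; exact_mod_cast hn0)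
  have hd : (⌊lam * n⌋₊ : ℝ) ≤ lam * n := Nat.floor_le (by positivity)
  have hdn : ⌊lam * n⌋₊ ≤ n := by
    have : (⌊lam * n⌋₊ : ℝ) ≤ n := by nlinarith
    exact_mod_cast this
  obtain ⟨k, hk⟩ := Nat.exists_eq_add_of_le hdn
  have hkn : (1 - lam) * n ≤ k := by
    have : (n : ℝ) = ⌊lam * n⌋₊ + k := by exact_mod_cast hk
    linarith
  have hk0 : 0 < k := by
    have : (0 : ℝ) < k := by linarith
    exact_mod_cast this
  have hM := hK.meanNorm_pos
  set M := meanNorm K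
  -- `b` is so close to `1` that `b ^ n` is at least `exp (-k / 2)`, which beats the small-ball
  -- probability `exp (-k)`.
  set b := exp (-((1 - lam) / 2)) with hb
  have hbp : b ^ p = exp (-(p * (1 - lam) / 2)) := by
    rw [hb, ← exp_mul]
    congr 1
    ring
  have hpos : 0 < 1 - exp (-(p * (1 - lam) / 2)) := by
    rw [sub_pos, exp_lt_one_iff]
    have : 0 < p * (1 - lam) / 2 := by positivity
    linarith
  set a := (1 - exp (-(p * (1 - lam) / 2))) ^ (1 / p) with ha
  have ha0 : 0 < a := rpow_pos_of_pos hpos _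
  have hab : a ^ p + b ^ p = 1 := by
    rw [hbp, ha, ← rpow_mul hpos.le, one_div_mul_cancel hp0.ne', rpow_one]
    ring
  have hkr : 4 * (exp 1 * (2 * M / (2 * exp 2 * M))) ^ k < b ^ Module.finrank ℝ V := by
    have h1 : exp 1 * (2 * M / (2 * exp 2 * M)) = exp (-1) := by
      rw [show (-1 : ℝ) = 1 - 2 by norm_num, exp_sub]
      field_simp
    have h2 : (4 : ℝ) < exp 2 := by
      rw [show (2 : ℝ) = (2 : ℕ) * 1 by norm_num, exp_nat_mul]
      nlinarith [exp_one_gt_d9]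
    rw [h1, hV, hb, ← exp_nat_mul, ← exp_nat_mul]
    calc 4 * exp (k * -1) < exp 2 * exp (k * -1) := by gcongr
      _ = exp (2 + k * -1) := (exp_add _ _).symm
      _ ≤ _ := exp_le_exp.2 (by linarith)
  obtain ⟨g, hg⟩ := exists_tuple_forall_mem_norm_lt hK.isCompact hKp (ρ := 2 * M)
    (r := 2 * exp 2 * M) (by positivity) (by positivity)
    (volume_le_two_mul_volume_inter_closedBall hK.isCompact hK.volume_real_pos hM)
    hK.volume_real_pos ha0 (exp_pos _) (exp_le_one_iff.2 (by linarith)) hab hk0 hkr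
  obtain ⟨E, hE, hEg⟩ := exists_submodule_finrank_eq_forall_inner_eq_zero g (hk.symm.trans hV.symm)
  refine ⟨E, hE, fun x hx => mul_norm_le_gauge_of_forall_norm_le hK.zero_mem_interior
    (R := (2 * exp 2 * M + 2 * M) / a) E (fun y hyE hy => ?_) (by positivity) ?_ hx⟩
  · rw [le_div_iff₀ ha0, mul_comm]
    exact (hg y hy (hEg y hyE)).le
  · have h := rpow_mul_le_exp_seven_rpow_mul hp0 hp1 ht0 (by linarith : 1 - lam ≤ 1)
    rw [div_mul_div_comm, div_le_one (by positivity)]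
    calc _ = (1 - lam) ^ (1 / 2 + 1 / p) * (2 * exp 2 + 2) * M := by ring
      _ ≤ _ := mul_le_mul_of_nonneg_right h hM.le
      _ = _ := by ring
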